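/- For a vector $c=(x_1,\dots,x_{10},y_1,y_2)\in\mathbb F_3^{12}$ write $x=(x_1,\dots,x_{10})$, and let $\mathrm{wt}$ denote the Hamming weight. A ternary $[n,k,d]$ code is a $k$-dimensional subspace of $\mathbb F_3^n$ whose minimum non-zero weight is $d$. Consider the following conditions on a ternary $[12,5]$ code $C$, required for every codeword $c=(x_1,\dots,x_{10},y_1,y_2)\in C$: (C1) $\mathrm{wt}(x)\equiv y_1y_2 \pmod 3$; (C2) if $c\neq 0$, then $\mathrm{wt}(x)\ge 3$; (C3) if $\mathrm{wt}(x)=3$, then $(y_1,y_2)\ne(0,0)$. Two ternary codes of length $12$ are SZ-equivalent if one is the image of the other under a map $$(x_1,\dots,x_{10},y_1,y_2)\mapsto((-1)^{\alpha_1}x_{\sigma(1)},\dots,(-1)^{\alpha_{10}}x_{\sigma(10)},(-1)^{\beta}y_{\tau(1)},(-1)^{\beta}y_{\tau(2)})$$ with $\alpha_1,\dots,\alpha_{10},\beta\in\{0,1\}$, $\sigma\in S_{10}$, $\tau\in S_2$. Two ternary codes of length $10$ are equivalent if one is obtained from the other by permuting the coordinates and changing the signs of certain coordinates. The punctured code $\mathrm{Pun}(C)\subseteq\mathbb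 F_3^{10}$ is obtained by deleting the last two coordinates of every codeword. For $i\in\{302,666,987,1245\}$ let $C_{10,3,i}$ be the ternary code of length $10$ with generator matrix $(I_5\mid A_i)$, and let $D_i$ be the ternary code of length $12$ with generator matrix $(I_5\mid A_i\mid B_i)$, where $$A_{302}=\begin{pmatrix}0&0&0&1&1\\0&1&1&0&0\\1&0&1&0&1\\1&1&0&1&0\\1&1&2&2&1\end{pmatrix},\ B_{302}=\begin{pmatrix}0&1\\0&1\\2&2\\2&2\\0&1\end{pmatrix},\quad A_{666}=\begin{pmatrix}0&0&0&1&1\\0&1&1&0&0\\1&0&1&0&1\\1&1&0&1&0\\1&2&2&2&2\end{pmatrix},\ B_{666}=\begin{pmatrix}0&1\\0&1\\2&2\\2&2\\2&0\end{pmatrix},$$ $$A_{987}=\begin{pmatrix}0&0&0&1&1\\0&0&1&0&1\\0&1&0&1&0\\0&1&1&0&0\\1&1&2&2&1\end{pmatrix},\ B_{987}=\begin{pmatrix}0&1\\2&0\\2&0\\0&1\\0&0\end{pmatrix},\quad A_{1245}=\begin{pmatrix}0&0&0&1&1\\0&0&1&0&1\\0&1&0&1&0\\0&1&1&0&0\\0&1&1&1&1\end{pmatrix},\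 B_{1245}=\begin{pmatrix}0&1\\2&0\\2&0\\0&1\\1&2\end{pmatrix}.$$ Lemma. Up to SZ-equivalence, there are exactly four ternary $[12,5,4]$ codes satisfying (C1)–(C3). More precisely, $D_{302},D_{666},D_{987},D_{1245}$ are ternary $[12,5,4]$ codes satisfying (C1)–(C3), and every ternary $[12,5,4]$ code satisfying (C1)–(C3) is SZ-equivalent to exactly one of them. Moreover $\mathrm{Pun}(D_i)=C_{10,3,i}$, the codes $C_{10,3,i}$ are pairwise inequivalent ternary $[10,5,3]$ codes, and for every ternary $[12,5,4]$ code $C$ satisfying (C1)–(C3), $\mathrm{Pun}(C)$ is a ternary $[10,5,3]$ code equivalent to exactly one of the four codes $C_{10,3,i}$. -/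

import Mathlib

/-- `C` is a ternary `[n, k, d]` code: a `k`-dimensional subspace of `𝔽₃ⁿ` whose minimum weight,
i.e. the least Hamming weight of a non-zero codeword, is `d`. -/
def IsTernaryCode {n : ℕ} (C : Submodule (ZMod 3) (Fin n → ZMod 3)) (k d : ℕ) : Prop :=
  Module.finrank (ZMod 3) C = k ∧ IsLeast {w : ℕ | ∃ c ∈ C, c ≠ 0 ∧ hammingNorm c = w} d

/-- `(x₁,…,x₁₀)` for a vector `(x₁,…,x₁₀,y₁,y₂)`, i.e. deletion of the coordinates 11 and 12. -/
def xPart : (Fin 12 → ZMod 3) →ₗ[ZMod 3] (Fin 10 → ZMod 3) where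
  toFun c := fun i => c (Fin.castAdd 2 i)
  map_add' _ _ := rfl
  map_smul' _ _ := rfl

/-- `(y₁,y₂)` for a vector `(x₁,…,x₁₀,y₁,y₂)`. -/
def yPart : (Fin 12 → ZMod 3) →ₗ[ZMod 3] (Fin 2 → ZMod 3) where
  toFun c := fun j => c (Fin.natAdd 10 j)
  map_add' _ _ := rfl
  map_smul' _ _ := rfl

/-- The punctured code of `C` on the coordinates `{11, 12}`. -/
def Pun (C : Submodule (ZMod 3) (Fin 12 → ZMod 3)) : Submodule (ZMod 3) (Fin 10 → ZMod 3) :=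
  C.map xPart

/-- The three conditions on a ternary code of length 12. -/
structure SZConditions (C : Submodule (ZMod 3) (Fin 12 → ZMod 3)) : Prop where
  c1 : ∀ c ∈ C, (hammingNorm (xPart c) : ZMod 3) = yPart c 0 * yPart c 1
  c2 : ∀ c ∈ C, c ≠ 0 → 3 ≤ hammingNorm (xPart c)
  c3 : ∀ c ∈ C, hammingNorm (xPart c) = 3 → (yPart c 0, yPart c 1) ≠ (0, 0)

/-- The map `(x₁,…,xₙ) ↦ ((-1)^α₁ x_{σ(1)},…,(-1)^αₙ x_{σ(n)})`. -/
def signedPerm {n : ℕ} (α : Fin n → Fin 2) (σ : Equiv.Perm (Fin n)) :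
    (Fin n → ZMod 3) →ₗ[ZMod 3] (Fin n → ZMod 3) where
  toFun x := fun i => (-1) ^ (α i : ℕ) * x (σ i)
  map_add' x y := by ext i; simp [mul_add]
  map_smul' r x := by ext i; simp [mul_left_comm]

/-- Usual equivalence of ternary codes: permuting coordinates and changing signs of some. -/
def CodeEquiv {n : ℕ} (C C' : Submodule (ZMod 3) (Fin n → ZMod 3)) : Prop :=
  ∃ (α : Fin n → Fin 2) (σ : Equiv.Perm (Fin n)), C' = C.map (signedPerm α σ)

/-- The map `(x₁,…,x₁₀,y₁,y₂) ↦
((-1)^α₁ x_{σ(1)},…,(-1)^α₁₀ x_{σ(10)}, (-1)^β y_{τ(1)}, (-1)^β y_{τ(2)})`. -/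
def szMap (α : Fin 10 → Fin 2) (β : Fin 2) (σ : Equiv.Perm (Fin 10)) (τ : Equiv.Perm (Fin 2)) :
    (Fin 12 → ZMod 3) →ₗ[ZMod 3] (Fin 12 → ZMod 3) where
  toFun c := Fin.append (m := 10) (n := 2)
    (fun i => (-1) ^ (α i : ℕ) * xPart c (σ i)) (fun j => (-1) ^ (β : ℕ) * yPart c (τ j))
  map_add' c d := by
    ext i
    refine Fin.addCases (m := 10) (n := 2) (fun i => ?_) (fun i => ?_) i
    · simp only [Pi.add_apply, Fin.append_left, map_add, mul_add]
    · simp only [Pi.add_apply, Fin.append_right, map_add, mul_add]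
  map_smul' r c := by
    ext i
    refine Fin.addCases (m := 10) (n := 2) (fun i => ?_) (fun i => ?_) i
    · simp only [Pi.smul_apply, Fin.append_left, map_smul, smul_eq_mul, RingHom.id_apply,
        mul_left_comm]
    · simp only [Pi.smul_apply, Fin.append_right, map_smul, smul_eq_mul, RingHom.id_apply,
        mul_left_comm]

/-- SZ-equivalence of ternary codes of length 12. -/
def SZEquiv (C C' : Submodule (ZMod 3) (Fin 12 → ZMod 3)) : Prop :=
  ∃ (α : Fin 10 → Fin 2) (β : Fin 2) (σ : Equiv.Perm (Fin 10)) (τ : Equiv.Perm (Fin 2)),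
    C' = C.map (szMap α β σ τ)

lemma neg_one_pow_fin_two_add (a b : Fin 2) :
    ((-1) ^ ((a + b : Fin 2) : ℕ) : ZMod 3) = (-1) ^ (a : ℕ) * (-1) ^ (b : ℕ) := by
  revert a b; decide

lemma szMap_id : szMap 0 0 1 1 = LinearMap.id := by
  refine LinearMap.ext fun c => funext fun i => ?_
  refine Fin.addCases (m := 10) (n := 2) (fun i => ?_) (fun i => ?_) i <;>
    simp [szMap, xPart, yPart]

lemma szMap_comp (α α' : Fin 10 → Fin 2) (β β' : Fin 2) (σ σ' : Equiv.Perm (Fin 10))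
    (τ τ' : Equiv.Perm (Fin 2)) :
    (szMap α' β' σ' τ').comp (szMap α β σ τ) =
      szMap (fun i => α' i + α (σ' i)) (β' + β) (σ * σ') (τ * τ') := by
  refine LinearMap.ext fun c => funext fun i => ?_
  refine Fin.addCases (m := 10) (n := 2) (fun i => ?_) (fun i => ?_) i <;>
    simp [szMap, xPart, yPart, neg_one_pow_fin_two_add, mul_assoc]

lemma szEquiv_equivalence : Equivalence SZEquiv where
  refl C := ⟨0, 0, 1, 1, by rw [szMap_id, Submodule.map_id]⟩
  symm := by
    rintro C C' ⟨α, β, σ, τ, rfl⟩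
    have h2 : ∀ a : Fin 2, a + a = 0 := by decide
    refine ⟨fun i => α (σ⁻¹ i), β, σ⁻¹, τ⁻¹, ?_⟩
    rw [← Submodule.map_comp, szMap_comp]
    simp only [h2, mul_inv_cancel]
    exact (congrArg (fun f => C.map f) szMap_id |>.trans (Submodule.map_id C)).symm
  trans := by
    rintro C C' C'' ⟨α, β, σ, τ, rfl⟩ ⟨α', β', σ', τ', rfl⟩
    exact ⟨_, _, _, _, by rw [← Submodule.map_comp, szMap_comp]⟩

/-- The ternary `[12, 5, 4]` codes satisfying the three conditions. -/
def SZCode : Type :=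
  {C : Submodule (ZMod 3) (Fin 12 → ZMod 3) // IsTernaryCode C 5 4 ∧ SZConditions C}

/-- SZ-equivalence of ternary `[12, 5, 4]` codes satisfying the three conditions. -/
def szSetoid : Setoid SZCode where
  r C C' := SZEquiv C.1 C'.1
  iseqv := ⟨fun C => szEquiv_equivalence.refl C.1, fun h => szEquiv_equivalence.symm h,
    fun h h' => szEquiv_equivalence.trans h h'⟩

/-- The code with generator matrix `G`. -/
def codeOf {k n : ℕ} (G : Matrix (Fin k) (Fin n) (ZMod 3)) :
    Submodule (ZMod 3) (Fin n → ZMod 3) :=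
  Submodule.span (ZMod 3) (Set.range G.row)

/-- Generator matrices `(I₅ | A)` of the codes `C_{10,3,302}`, `C_{10,3,666}`, `C_{10,3,987}`,
`C_{10,3,1245}`, in this order. -/
def G10 : Fin 4 → Matrix (Fin 5) (Fin 10) (ZMod 3) := ![
  !![1, 0, 0, 0, 0, 0, 0, 0, 1, 1;
     0, 1, 0, 0, 0, 0, 1, 1, 0, 0;
     0, 0, 1, 0, 0, 1, 0, 1, 0, 1;
     0, 0, 0, 1, 0, 1, 1, 0, 1, 0;
     0, 0, 0, 0, 1, 1, 1, 2, 2, 1],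
  !![1, 0, 0, 0, 0, 0, 0, 0, 1, 1;
     0, 1, 0, 0, 0, 0, 1, 1, 0, 0;
     0, 0, 1, 0, 0, 1, 0, 1, 0, 1;
     0, 0, 0, 1, 0, 1, 1, 0, 1, 0;
     0, 0, 0, 0, 1, 1, 2, 2, 2, 2],
  !![1, 0, 0, 0, 0, 0, 0, 0, 1, 1;
     0, 1, 0, 0, 0, 0, 0, 1, 0, 1;
     0, 0, 1, 0, 0, 0, 1, 0, 1, 0;
     0, 0, 0, 1, 0, 0, 1, 1, 0, 0;
     0, 0, 0, 0, 1, 1, 1, 2, 2, 1],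
  !![1, 0, 0, 0, 0, 0, 0, 0, 1, 1;
     0, 1, 0, 0, 0, 0, 0, 1, 0, 1;
     0, 0, 1, 0, 0, 0, 1, 0, 1, 0;
     0, 0, 0, 1, 0, 0, 1, 1, 0, 0;
     0, 0, 0, 0, 1, 0, 1, 1, 1, 1]]

/-- The columns `(aᵀ, bᵀ)` by which the four matrices of `G10` are extended. -/
def ab : Fin 4 → Matrix (Fin 5) (Fin 2) (ZMod 3) := ![
  !![0, 1; 0, 1; 2, 2; 2, 2; 0, 1],
  !![0, 1; 0, 1; 2, 2; 2, 2; 2, 0],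
  !![0, 1; 2, 0; 2, 0; 0, 1; 0, 0],
  !![0, 1; 2, 0; 2, 0; 0, 1; 1, 2]]

/-- The codes `C_{10,3,302}`, `C_{10,3,666}`, `C_{10,3,987}`, `C_{10,3,1245}`. -/
def C10 (i : Fin 4) : Submodule (ZMod 3) (Fin 10 → ZMod 3) := codeOf (G10 i)

/-- The codes of length 12 with generator matrices `(I₅ | A | aᵀ bᵀ)`. -/
def C12 (i : Fin 4) : Submodule (ZMod 3) (Fin 12 → ZMod 3) :=
  codeOf (Matrix.of fun r => Fin.append (m := 10) (n := 2) (G10 i r) (ab i r))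

/-! Non-zero elements of 𝔽₃ have square 1, so (C1) says that the quadratic form `∑ xᵢ² - y₁y₂`
vanishes on `C`. By polarization `C` is totally isotropic for `∑ xᵢx'ᵢ + y₁y'₂ + y₂y'₁`
(`IsSZ.orth`). Since `dim C = 5`, some non-zero word vanishes at any four given coordinates
(`IsSZ.exists_vanishing`). Orthogonality to the words already found leaves few free parameters in
it, (C1)–(C3) restrict these by a finite check, and an SZ-map keeping the earlier words in the code
brings the new word to a normal form.

Minimum weight 4 forces a word with `wt(x) = 3`, normalized to `block₁`. A word vanishing at `x₁,
x₂, x₃, y₁` has weight 6 and leads to a second word with `wt(x) = 3`, whose x-support is disjoint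
from the first. If that support lies inside the one of the weight 6 word, there are three disjoint
blocks (`exists_szEquiv_of_blocks`). Otherwise the code contains `block₂'` and `glue₂`
(`exists_szEquiv_of_glue₂`). Two further words complete a basis: the first branch ends in `C12 3` or
`C12 1`, the second in `C12 2` or `C12 0`.

The four codes are told apart by the number of words of weight 3 in their punctured codes, namely 4,
6, 8, 12 (`weightThreeCount_C10`). -/

open Function

/-- The three conditions on a ternary code of length 12, for a single vector. -/
def Admissible (c : Fin 12 → ZMod 3) : Prop :=
  (hammingNorm (xPart c) : ZMod 3) = yPart c 0 * yPart c 1 ∧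
    (c ≠ 0 → 3 ≤ hammingNorm (xPart c)) ∧
    (hammingNorm (xPart c) = 3 → (yPart c 0, yPart c 1) ≠ (0, 0))

instance : DecidablePred Admissible := fun c => by unfold Admissible; infer_instance

lemma szConditions_iff {C : Submodule (ZMod 3) (Fin 12 → ZMod 3)} :
    SZConditions C ↔ ∀ c ∈ C, Admissible c :=
  ⟨fun h c hc => ⟨h.c1 c hc, h.c2 c hc, h.c3 c hc⟩,
    fun h => ⟨fun c hc => (h c hc).1, fun c hc => (h c hc).2.1, fun c hc => (h c hc).2.2⟩⟩

/-! ### Signed permutations -/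

lemma neg_one_pow_mul_eq_zero {a : Fin 2} {x : ZMod 3} : (-1) ^ (a : ℕ) * x = 0 ↔ x = 0 := by
  revert a x; decide

lemma hammingNorm_signedPerm {n : ℕ} (α : Fin n → Fin 2) (σ : Equiv.Perm (Fin n))
    (x : Fin n → ZMod 3) : hammingNorm (signedPerm α σ x) = hammingNorm x := by
  refine Finset.card_equiv σ fun i => ?_
  simp [signedPerm]

lemma signedPerm_injective {n : ℕ} (α : Fin n → Fin 2) (σ : Equiv.Perm (Fin n)) :
    Injective (signedPerm α σ) := by
  refine (injective_iff_map_eq_zero _).2 fun x hx => ?_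
  rw [← hammingNorm_eq_zero, ← hammingNorm_signedPerm α σ, hx, hammingNorm_zero]

section szMap

variable (α : Fin 10 → Fin 2) (β : Fin 2) (σ : Equiv.Perm (Fin 10)) (τ : Equiv.Perm (Fin 2))

lemma xPart_szMap (c : Fin 12 → ZMod 3) : xPart (szMap α β σ τ c) = signedPerm α σ (xPart c) := by
  ext i; simp [szMap, xPart, signedPerm]

lemma yPart_szMap (c : Fin 12 → ZMod 3) (j : Fin 2) :
    yPart (szMap α β σ τ c) j = (-1) ^ (β : ℕ) * yPart c (τ j) := by
  simp [szMap, yPart]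

lemma szMap_castAdd (c : Fin 12 → ZMod 3) (i : Fin 10) :
    szMap α β σ τ c (Fin.castAdd 2 i) = (-1) ^ (α i : ℕ) * c (Fin.castAdd 2 (σ i)) :=
  congrFun (xPart_szMap α β σ τ c) i

lemma szMap_natAdd (c : Fin 12 → ZMod 3) (j : Fin 2) :
    szMap α β σ τ c (Fin.natAdd 10 j) = (-1) ^ (β : ℕ) * c (Fin.natAdd 10 (τ j)) :=
  yPart_szMap α β σ τ c j

lemma szMap_injective : Injective (szMap α β σ τ) := by
  refine (injective_iff_map_eq_zero _).2 fun c hc => funext fun i => ?_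
  refine Fin.addCases (m := 10) (n := 2) (fun i => ?_) (fun j => ?_) i
  · have := congrFun hc (Fin.castAdd 2 (σ.symm i))
    rw [szMap_castAdd] at this
    simpa [neg_one_pow_mul_eq_zero] using this
  · have := congrFun hc (Fin.natAdd 10 (τ.symm j))
    rw [szMap_natAdd] at this
    simpa [neg_one_pow_mul_eq_zero] using this

lemma Admissible.map {c : Fin 12 → ZMod 3} (h : Admissible c) :
    Admissible (szMap α β σ τ c) := by
  obtain ⟨h1, h2, h3⟩ := h
  have hy : ∀ a b : ZMod 3, ((-1) ^ (β : ℕ) * a, (-1) ^ (β : ℕ) * b) = (0, 0) ↔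
      (a, b) = (0, 0) := by
    simp
  have hm : ∀ (β : Fin 2) (a b : ZMod 3),
      (-1) ^ (β : ℕ) * a * ((-1) ^ (β : ℕ) * b) = a * b := by decide
  have hc : ∀ (τ : Equiv.Perm (Fin 2)) (f : Fin 2 → ZMod 3), f (τ 0) * f (τ 1) = f 0 * f 1 ∧
      ((f (τ 0), f (τ 1)) = (0, 0) ↔ (f 0, f 1) = (0, 0)) := by decide +kernel
  unfold Admissible
  simp only [xPart_szMap, yPart_szMap, hammingNorm_signedPerm, hm, hc, ne_eq, hy]
  exact ⟨h1, fun h => h2 fun h0 => h (by rw [h0, map_zero]), h3⟩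

end szMap

lemma CodeEquiv.of_szEquiv {C C' : Submodule (ZMod 3) (Fin 12 → ZMod 3)} (h : SZEquiv C C') :
    CodeEquiv (Pun C) (Pun C') := by
  obtain ⟨α, β, σ, τ, rfl⟩ := h
  refine ⟨α, σ, ?_⟩
  unfold Pun
  rw [← Submodule.map_comp, ← Submodule.map_comp]
  exact congrArg (fun f => C.map f) (LinearMap.ext fun c => xPart_szMap α β σ τ c)

/-! ### Orthogonality -/

/-- The codes satisfying the three conditions which have dimension 5. -/
structure IsSZ (C : Submodule (ZMod 3) (Fin 12 → ZMod 3)) : Prop where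
  finrank : Module.finrank (ZMod 3) C = 5
  admissible : ∀ c ∈ C, Admissible c

lemma hammingNorm_cast {n : ℕ} (x : Fin n → ZMod 3) :
    (hammingNorm x : ZMod 3) = ∑ i, x i * x i := by
  have : ∀ a : ZMod 3, a * a = if a ≠ 0 then 1 else 0 := by decide
  simp_rw [this]
  exact Finset.natCast_card_filter _ _

lemma IsSZ.quad {C : Submodule (ZMod 3) (Fin 12 → ZMod 3)} (hC : IsSZ C) {c : Fin 12 → ZMod 3}
    (hc : c ∈ C) : c 0 * c 0 + c 1 * c 1 + c 2 * c 2 + c 3 * c 3 + c 4 * c 4 + c 5 * c 5 +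
      c 6 * c 6 + c 7 * c 7 + c 8 * c 8 + c 9 * c 9 = c 10 * c 11 := by
  have := (hC.admissible c hc).1
  rw [hammingNorm_cast] at this
  simp only [Fin.sum_univ_succ, Fin.sum_univ_zero] at this
  simp only [add_assoc]
  simp only [add_zero] at this
  exact this

lemma IsSZ.orth {C : Submodule (ZMod 3) (Fin 12 → ZMod 3)} (hC : IsSZ C) {c d : Fin 12 → ZMod 3}
    (hc : c ∈ C) (hd : d ∈ C) : c 0 * d 0 + c 1 * d 1 + c 2 * d 2 + c 3 * d 3 + c 4 * d 4 +
      c 5 * d 5 + c 6 * d 6 + c 7 * d 7 + c 8 * d 8 + c 9 * d 9 + c 10 * d 11 +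
      c 11 * d 10 = 0 := by
  have h1 := hC.quad hc
  have h2 := hC.quad hd
  have h3 := hC.quad (C.add_mem hc hd)
  simp only [Pi.add_apply] at h3
  have h4 : (3 : ZMod 3) = 0 := rfl
  -- The factor 2 inverts the 2 produced by polarization; the `h4` term removes multiples of 3.
  linear_combination 2 * (h3 - h1 - h2) - (c 0 * d 0 + c 1 * d 1 + c 2 * d 2 + c 3 * d 3 +
    c 4 * d 4 + c 5 * d 5 + c 6 * d 6 + c 7 * d 7 + c 8 * d 8 + c 9 * d 9 - c 10 * d 11 -
    c 11 * d 10) * h4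

lemma IsSZ.map {C : Submodule (ZMod 3) (Fin 12 → ZMod 3)} (hC : IsSZ C) (α : Fin 10 → Fin 2)
    (β : Fin 2) (σ : Equiv.Perm (Fin 10)) (τ : Equiv.Perm (Fin 2)) :
    IsSZ (C.map (szMap α β σ τ)) := by
  refine ⟨?_, ?_⟩
  · rw [← hC.finrank]
    exact (C.equivMapOfInjective _ (szMap_injective α β σ τ)).finrank_eq.symm
  · rintro _ ⟨c, hc, rfl⟩
    exact (hC.admissible c hc).map α β σ τ

/-- A 5-dimensional code has a non-zero word vanishing at four given coordinates. -/
lemma IsSZ.exists_vanishing {C : Submodule (ZMod 3) (Fin 12 → ZMod 3)} (hC : IsSZ C)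
    (k : Fin 4 → Fin 12) : ∃ c ∈ C, c ≠ 0 ∧ ∀ j, c (k j) = 0 := by
  let f : C →ₗ[ZMod 3] (Fin 4 → ZMod 3) := (LinearMap.funLeft (ZMod 3) (ZMod 3) k).domRestrict C
  have hf : LinearMap.ker f ≠ ⊥ := LinearMap.ker_ne_bot_of_finrank_lt (by simp [hC.finrank])
  obtain ⟨⟨c, hc⟩, hk, h0⟩ := Submodule.exists_mem_ne_zero_of_ne_bot hf
  exact ⟨c, hc, fun h => h0 (Subtype.ext h), fun j => congrFun (LinearMap.mem_ker.1 hk) j⟩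

/-! ### Moving the support of a vector -/

lemma antitone_support_iff {m : ℕ} (x : Fin m → ZMod 3) (hx : ∀ i j, i ≤ j → x j ≠ 0 → x i ≠ 0)
    (j : Fin m) : x j ≠ 0 ↔ (j : ℕ) < hammingNorm x := by
  constructor
  · intro h
    have : Finset.Iic j ⊆ Finset.univ.filter fun i => x i ≠ 0 := fun i hi => by
      simpa using hx i j (Finset.mem_Iic.1 hi) h
    have := Finset.card_le_card this
    rw [Fin.card_Iic] at this
    exact this
  · intro h h0
    have : (Finset.univ.filter fun i => x i ≠ 0) ⊆ Finset.Iio j := fun i hi => by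
      rw [Finset.mem_Iio]
      by_contra hij
      exact hx j i (not_lt.1 hij) (Finset.mem_filter.1 hi).2 h0
    have := Finset.card_le_card this
    rw [Fin.card_Iio] at this
    exact absurd h (not_lt.2 this)

/-- Normalizes the support of `x` inside the block `range f` without spoiling earlier choices: only
the block is permuted, its non-zero entries come first, and every non-zero entry of `x` becomes 1.
By the last clause, words that vanish on the block, and outside it wherever `x` does not, stay
fixed. -/
lemma exists_perm_support {m n : ℕ} (f : Fin m ↪ Fin n) (x : Fin n → ZMod 3) :
    ∃ (α : Fin n → Fin 2) (σ : Equiv.Perm (Fin n)), (∀ i ∉ Set.range f, σ i = i) ∧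
      (∀ j, σ (f j) ∈ Set.range f) ∧
      (∀ i, signedPerm α σ x i = if x (σ i) = 0 then 0 else 1) ∧
      (∀ j, x (σ (f j)) = 0 ↔ hammingNorm (x ∘ f) ≤ j) ∧
      ∀ d : Fin n → ZMod 3, (∀ j, d (f j) = 0) → (∀ i ∉ Set.range f, x i = 0 ∨ d i = 0) →
        signedPerm α σ d = d := by
  -- Zeros get the larger key, so sorting moves them to the end of the block.
  let key : Fin m → ℕ := fun j => if x (f j) = 0 then 1 else 0
  let π := Tuple.sort key
  have hπ : Monotone (key ∘ π) := Tuple.monotone_sort key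
  let σ := π.viaFintypeEmbedding f
  have hσ : ∀ j, σ (f j) = f (π j) := fun j => Equiv.Perm.viaFintypeEmbedding_apply_image π f j
  have hσ' : ∀ i ∉ Set.range f, σ i = i := fun i hi =>
    Equiv.Perm.viaFintypeEmbedding_apply_notMem_range π f hi
  have hs : ∀ a : ZMod 3, ((-1) ^ ((if a = 2 then 1 else 0 : Fin 2) : ℕ) * a : ZMod 3) =
      if a = 0 then 0 else 1 := by decide
  refine ⟨fun i => if x (σ i) = 2 then 1 else 0, σ, hσ', fun j => ⟨π j, (hσ j).symm⟩,
    fun i => hs _, fun j => ?_, fun d hd hxd => funext fun i => ?_⟩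
  · have hn : hammingNorm (x ∘ f) = hammingNorm (x ∘ f ∘ π) :=
      (Finset.card_equiv π fun i => by simp).symm
    rw [hσ, hn, ← not_lt, ← not_ne_iff]
    refine not_congr (antitone_support_iff (x ∘ f ∘ π) (fun i j hij hj h0 => ?_) j)
    have := hπ hij
    simp only [comp_apply, key] at this hj h0
    simp [hj, h0] at this
  · simp only [signedPerm, LinearMap.coe_mk, AddHom.coe_mk]
    by_cases hi : i ∈ Set.range f
    · obtain ⟨j, rfl⟩ := hi
      rw [hσ, hd, hd, mul_zero]
    · rw [hσ' i hi]
      obtain h | h := hxd i hi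
      · rw [h, if_neg (by decide)]
        exact one_mul _
      · rw [h, mul_zero]

lemma hammingNorm_comp_embedding {m n : ℕ} (f : Fin m ↪ Fin n) (x : Fin n → ZMod 3)
    (h : ∀ i ∉ Set.range f, x i = 0) : hammingNorm (x ∘ f) = hammingNorm x := by
  unfold hammingNorm
  rw [← Finset.card_map f]
  congr 1
  ext i
  simp only [Finset.mem_map, Finset.mem_filter, Finset.mem_univ, true_and, comp_apply]
  constructor
  · rintro ⟨j, hj, rfl⟩
    exact hj
  · intro hi
    by_contra hc
    refine hi (h i ?_)
    rintro ⟨j, rfl⟩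
    exact hc ⟨j, hi, rfl⟩

lemma eq_vec (c : Fin 12 → ZMod 3) :
    c = ![c 0, c 1, c 2, c 3, c 4, c 5, c 6, c 7, c 8, c 9, c 10, c 11] := by
  ext i; fin_cases i <;> rfl

/-! ### Admissibility in terms of coordinates -/

lemma hammingNorm_eq_add (c : Fin 12 → ZMod 3) :
    hammingNorm c = hammingNorm (xPart c) + hammingNorm (yPart c) := by
  unfold hammingNorm
  simp only [Finset.card_filter]
  exact Fin.sum_univ_add fun i : Fin (10 + 2) => if c i ≠ 0 then 1 else 0

/-- On the values 0, 1, 2 the expression `(a + 1) / 2` is 0, 1, 1, the indicator of being non-zero.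
-/
lemma hammingNorm_eq_sum_val {n : ℕ} (x : Fin n → ZMod 3) :
    hammingNorm x = ∑ i, ((x i).val + 1) / 2 := by
  have : ∀ a : ZMod 3, (a.val + 1) / 2 = if a ≠ 0 then 1 else 0 := by decide
  simp only [this]
  exact Finset.card_filter _ _

/-- Admissibility of a vector in terms of its coordinates, in arithmetic of natural numbers. -/
def AdmissibleCoords (a b c d e f g h i j u v : ZMod 3) : Prop :=
  let w := (a.val + 1) / 2 + (b.val + 1) / 2 + (c.val + 1) / 2 + (d.val + 1) / 2 +
    (e.val + 1) / 2 + (f.val + 1) / 2 + (g.val + 1) / 2 + (h.val + 1) / 2 + (i.val + 1) / 2 +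
    (j.val + 1) / 2
  w % 3 = u.val * v.val % 3 ∧ (w + (u.val + v.val) ≠ 0 → 3 ≤ w) ∧ (w = 3 → u.val + v.val ≠ 0)

instance (a b c d e f g h i j u v : ZMod 3) :
    Decidable (AdmissibleCoords a b c d e f g h i j u v) := by
  unfold AdmissibleCoords; infer_instance

lemma hammingNorm_xPart (c : Fin 12 → ZMod 3) : hammingNorm (xPart c) =
    ((c 0).val + 1) / 2 + ((c 1).val + 1) / 2 + ((c 2).val + 1) / 2 + ((c 3).val + 1) / 2 +
      ((c 4).val + 1) / 2 + ((c 5).val + 1) / 2 + ((c 6).val + 1) / 2 + ((c 7).val + 1) / 2 +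
      ((c 8).val + 1) / 2 + ((c 9).val + 1) / 2 := by
  rw [hammingNorm_eq_sum_val]
  simp only [Fin.sum_univ_succ, Fin.sum_univ_zero, add_assoc, add_zero]
  rfl

/-- Turns the conditions into plain arithmetic of natural numbers, in which the exhaustive checks
are feasible for the kernel. -/
lemma admissible_iff (c : Fin 12 → ZMod 3) : Admissible c ↔ AdmissibleCoords (c 0) (c 1) (c 2)
    (c 3) (c 4) (c 5) (c 6) (c 7) (c 8) (c 9) (c 10) (c 11) := by
  unfold Admissible AdmissibleCoords
  simp only [← hammingNorm_xPart]
  have h0 : ∀ y : Fin 2 → ZMod 3,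
      ((y 0, y 1) = (0, 0) ↔ (y 0).val + (y 1).val = 0) ∧
      (hammingNorm y = 0 ↔ (y 0).val + (y 1).val = 0) := by decide
  have hc : c = 0 ↔ hammingNorm (xPart c) + ((yPart c 0).val + (yPart c 1).val) = 0 := by
    rw [← hammingNorm_eq_zero, hammingNorm_eq_add, Nat.add_eq_zero_iff, Nat.add_eq_zero_iff,
      (h0 _).2]
  refine and_congr ?_ (and_congr ?_ ?_)
  · rw [← ZMod.natCast_eq_natCast_iff', Nat.cast_mul, ZMod.natCast_zmod_val,
      ZMod.natCast_zmod_val]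
    rfl
  · rw [ne_eq, hc]
    rfl
  · rw [ne_eq, (h0 _).1]
    rfl

/-! ### The four codes -/

lemma mem_codeOf {k n : ℕ} {G : Matrix (Fin k) (Fin n) (ZMod 3)} {c : Fin n → ZMod 3} :
    c ∈ codeOf G ↔ ∃ g : Fin k → ZMod 3, Matrix.vecMul g G = c := by
  unfold codeOf
  rw [Submodule.mem_span_range_iff_exists_fun]
  simp only [Matrix.vecMul_eq_sum]
  rfl

lemma finrank_codeOf {k n : ℕ} {G : Matrix (Fin k) (Fin n) (ZMod 3)}
    (h : ∀ g : Fin k → ZMod 3, Matrix.vecMul g G = 0 → g = 0) :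
    Module.finrank (ZMod 3) (codeOf G) = k := by
  have hli : LinearIndependent (ZMod 3) G.row := by
    rw [Fintype.linearIndependent_iff]
    intro g hg i
    refine congrFun (h g ?_) i
    rw [Matrix.vecMul_eq_sum]
    exact hg
  have := finrank_span_eq_card hli
  rwa [Fintype.card_fin] at this

/-- The generator matrix of `C12 i`. -/
def G12 (i : Fin 4) : Matrix (Fin 5) (Fin 12) (ZMod 3) :=
  Matrix.of fun r => Fin.append (m := 10) (n := 2) (G10 i r) (ab i r)

lemma C12_eq (i : Fin 4) : C12 i = codeOf (G12 i) := rfl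

lemma vecMul_G10_eq_zero (i : Fin 4) (g : Fin 5 → ZMod 3) (h : Matrix.vecMul g (G10 i) = 0) :
    g = 0 := by
  have h0 := congrFun h 0
  have h1 := congrFun h 1
  have h2 := congrFun h 2
  have h3 := congrFun h 3
  have h4 := congrFun h 4
  simp only [Matrix.vecMul, dotProduct, Fin.sum_univ_five] at h0 h1 h2 h3 h4
  ext r
  fin_cases i <;> simp [G10] at h0 h1 h2 h3 h4 <;> fin_cases r <;> assumption

set_option maxRecDepth 100000 in
lemma admissible_vecMul_G12 (i : Fin 4) (g : Fin 5 → ZMod 3) :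
    Admissible (Matrix.vecMul g (G12 i)) := by
  rw [admissible_iff]
  simp only [Matrix.vecMul, dotProduct, Fin.sum_univ_five]
  generalize g 0 = a
  generalize g 1 = b
  generalize g 2 = c
  generalize g 3 = d
  generalize g 4 = e
  revert a b c d e
  fin_cases i <;>
  · simp [G12, G10, ab, Fin.append, Fin.addCases]
    decide +kernel

set_option maxRecDepth 100000 in
lemma card_weight_three_G10 (i : Fin 4) :
    (Finset.univ.filter fun g : Fin 5 → ZMod 3 =>
      hammingNorm (Matrix.vecMul g (G10 i)) = 3).card = ![4, 6, 8, 12] i := by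
  simp only [hammingNorm_eq_sum_val, Fin.sum_univ_succ, Matrix.vecMul, dotProduct,
    Fin.sum_univ_zero, add_zero]
  fin_cases i <;>
  · simp [G10]
    decide +kernel

lemma xPart_vecMul_G12 (i : Fin 4) (g : Fin 5 → ZMod 3) :
    xPart (Matrix.vecMul g (G12 i)) = Matrix.vecMul g (G10 i) := by
  ext j
  simp [xPart, G12, Matrix.vecMul, dotProduct]

lemma pun_C12 (i : Fin 4) : Pun (C12 i) = C10 i := by
  ext c
  simp only [Pun, C12_eq, C10, Submodule.mem_map, mem_codeOf, exists_exists_eq_and,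
    xPart_vecMul_G12]

lemma isSZ_C12 (i : Fin 4) : IsSZ (C12 i) where
  finrank := finrank_codeOf fun g hg => vecMul_G10_eq_zero i g <| by
    rw [← xPart_vecMul_G12]
    exact (congrArg xPart hg).trans (map_zero _)
  admissible := by
    intro c hc
    obtain ⟨g, rfl⟩ := mem_codeOf.1 hc
    exact admissible_vecMul_G12 i g

/-- The number of words of weight 3 in a code. -/
noncomputable def weightThreeCount {n : ℕ} (C : Submodule (ZMod 3) (Fin n → ZMod 3)) : ℕ :=
  Set.ncard {c | c ∈ C ∧ hammingNorm c = 3}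

lemma CodeEquiv.weightThreeCount_eq {n : ℕ} {C C' : Submodule (ZMod 3) (Fin n → ZMod 3)}
    (h : CodeEquiv C C') : weightThreeCount C = weightThreeCount C' := by
  obtain ⟨α, σ, rfl⟩ := h
  unfold weightThreeCount
  rw [← Set.ncard_image_of_injective _ (signedPerm_injective α σ)]
  congr 1
  ext c
  constructor
  · rintro ⟨d, ⟨hd, hw⟩, rfl⟩
    exact ⟨⟨d, hd, rfl⟩, by rwa [hammingNorm_signedPerm]⟩
  · rintro ⟨⟨d, hd, rfl⟩, hw⟩
    exact ⟨d, ⟨hd, by rwa [hammingNorm_signedPerm] at hw⟩, rfl⟩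

lemma weightThreeCount_C10 (i : Fin 4) : weightThreeCount (C10 i) = ![4, 6, 8, 12] i := by
  have hinj : Injective fun g : Fin 5 → ZMod 3 => Matrix.vecMul g (G10 i) := fun g h hgh => by
    refine sub_eq_zero.1 (vecMul_G10_eq_zero i _ ?_)
    rw [Matrix.sub_vecMul]
    exact sub_eq_zero.2 hgh
  rw [← card_weight_three_G10, ← Set.ncard_coe_finset, ← Set.ncard_image_of_injective _ hinj]
  unfold weightThreeCount
  congr 1
  ext c
  simp only [C10, mem_codeOf, Set.mem_ofPred_eq, Finset.coe_filter, Finset.mem_univ, true_and,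
    Set.mem_image]
  constructor
  · rintro ⟨⟨g, rfl⟩, h⟩
    exact ⟨g, h, rfl⟩
  · rintro ⟨g, h, rfl⟩
    exact ⟨⟨g, rfl⟩, h⟩

/-- The number of words of weight 3 is an invariant, and its values 4, 6, 8, 12 are distinct. -/
lemma C10_injective_of_codeEquiv {C : Submodule (ZMod 3) (Fin 10 → ZMod 3)} {i j : Fin 4}
    (hi : CodeEquiv C (C10 i)) (hj : CodeEquiv C (C10 j)) : i = j := by
  have h := hi.weightThreeCount_eq.symm.trans hj.weightThreeCount_eq
  rw [weightThreeCount_C10, weightThreeCount_C10] at h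
  exact (by decide : ∀ i j : Fin 4, (![4, 6, 8, 12] : Fin 4 → ℕ) i = ![4, 6, 8, 12] j → i = j) i j h

lemma codeEquiv_refl {n : ℕ} (C : Submodule (ZMod 3) (Fin n → ZMod 3)) : CodeEquiv C C := by
  have : signedPerm (0 : Fin n → Fin 2) 1 = LinearMap.id :=
    LinearMap.ext fun x => funext fun i => by simp [signedPerm]
  exact ⟨0, 1, by rw [this, Submodule.map_id]⟩

/-! ### Minimum weights -/

lemma hammingNorm_yPart : ∀ y : Fin 2 → ZMod 3,
    ((y 0, y 1) ≠ (0, 0) → 1 ≤ hammingNorm y) ∧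
    ((y 0, y 1) ≠ (0, 0) → y 0 * y 1 = 0 → hammingNorm y = 1) ∧
    (y 0 * y 1 = 1 → 1 ≤ hammingNorm y) := by
  decide

variable {C : Submodule (ZMod 3) (Fin 12 → ZMod 3)}

lemma IsSZ.xPart_injOn (hC : IsSZ C) : Injective (xPart.domRestrict C) := by
  refine (injective_iff_map_eq_zero _).2 fun c hc => ?_
  by_contra h
  have := (hC.admissible c c.2).2.1 fun h0 => h (Subtype.ext h0)
  rw [show xPart c = 0 from hc, hammingNorm_zero] at this
  omega

/-- If `wt(x) = 3`, then `y₁y₂ = 0` by (C1) and `y ≠ 0` by (C3), so exactly one of `y₁, y₂` is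
non-zero and the total weight is 4. All other non-zero words have `wt(x) ≥ 4`. -/
lemma IsSZ.isTernaryCode (hC : IsSZ C) (h : ∃ c ∈ C, hammingNorm (xPart c) = 3) :
    IsTernaryCode C 5 4 := by
  refine ⟨hC.finrank, ?_, ?_⟩
  · obtain ⟨c, hc, hw⟩ := h
    have ha := hC.admissible c hc
    refine ⟨c, hc, fun h0 => ?_, ?_⟩
    · rw [h0, map_zero, hammingNorm_zero] at hw
      omega
    · rw [hammingNorm_eq_add, hw, (hammingNorm_yPart _).2.1 (ha.2.2 hw)]
      rw [← ha.1, hw]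
      rfl
  · rintro _ ⟨c, hc, h0, rfl⟩
    have ha := hC.admissible c hc
    rw [hammingNorm_eq_add]
    obtain h3 | h3 := (ha.2.1 h0).eq_or_lt
    · have := (hammingNorm_yPart _).1 (ha.2.2 h3.symm)
      omega
    · omega

lemma IsSZ.isTernaryCode_pun (hC : IsSZ C) (h : ∃ c ∈ C, hammingNorm (xPart c) = 3) :
    IsTernaryCode (Pun C) 5 3 := by
  refine ⟨?_, ?_, ?_⟩
  · rw [← hC.finrank, ← LinearMap.finrank_range_of_inj hC.xPart_injOn,
      LinearMap.range_domRestrict]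
    rfl
  · obtain ⟨c, hc, hw⟩ := h
    refine ⟨xPart c, ⟨c, hc, rfl⟩, fun h0 => ?_, hw⟩
    rw [h0, hammingNorm_zero] at hw
    omega
  · rintro _ ⟨_, ⟨c, hc, rfl⟩, h0, rfl⟩
    exact (hC.admissible c hc).2.1 fun h => h0 (by rw [h, map_zero])

/-- A word of weight 4 with `wt(x) = 4` would have `y = 0`, against `y₁y₂ = 1`. -/
lemma IsSZ.exists_weight_three (hC : IsSZ C) (h : IsTernaryCode C 5 4) :
    ∃ c ∈ C, hammingNorm (xPart c) = 3 := by
  obtain ⟨c, hc, h0, hw⟩ := h.2.1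
  have ha := hC.admissible c hc
  refine ⟨c, hc, ?_⟩
  have h3 := ha.2.1 h0
  rw [hammingNorm_eq_add] at hw
  by_contra hne
  have h4 : hammingNorm (xPart c) = 4 := by omega
  have := (hammingNorm_yPart (yPart c)).2.2 (by rw [← ha.1, h4]; rfl)
  omega

lemma exists_weight_three_C12 (i : Fin 4) : ∃ c ∈ C12 i, hammingNorm (xPart c) = 3 := by
  have hpos : 0 < (Finset.univ.filter fun g : Fin 5 → ZMod 3 =>
      hammingNorm (Matrix.vecMul g (G10 i)) = 3).card := by
    rw [card_weight_three_G10]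
    revert i
    decide
  obtain ⟨g, hg⟩ := Finset.card_pos.1 hpos
  refine ⟨Matrix.vecMul g (G12 i), mem_codeOf.2 ⟨g, rfl⟩, ?_⟩
  rw [xPart_vecMul_G12]
  exact (Finset.mem_filter.1 hg).2

/-! ### Normal forms -/

/-- The reduction principle: by transitivity, `C` may be replaced by an image containing the
prescribed words `g'`. -/
lemma exists_szEquiv_of_image {l : ℕ} (g' : Fin l → Fin 12 → ZMod 3) (hC : IsSZ C)
    (α : Fin 10 → Fin 2) (β : Fin 2) (σ : Equiv.Perm (Fin 10)) (τ : Equiv.Perm (Fin 2))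
    (h : ∀ r, ∃ c ∈ C, szMap α β σ τ c = g' r)
    (H : ∀ C', IsSZ C' → (∀ r, g' r ∈ C') → ∃ i, SZEquiv C' (C12 i)) :
    ∃ i, SZEquiv C (C12 i) := by
  obtain ⟨i, hi⟩ := H _ (hC.map α β σ τ) h
  exact ⟨i, szEquiv_equivalence.trans ⟨α, β, σ, τ, rfl⟩ hi⟩

lemma exists_szEquiv_of_combination {k l : ℕ} {g : Fin k → Fin 12 → ZMod 3}
    (g' : Fin l → Fin 12 → ZMod 3) (hC : IsSZ C) (hg : ∀ j, g j ∈ C)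
    (α : Fin 10 → Fin 2) (σ : Equiv.Perm (Fin 10)) (τ : Equiv.Perm (Fin 2))
    (M : Fin l → Fin k → ZMod 3)
    (hM : ∀ r, szMap α 0 σ τ (Matrix.vecMul (M r) (Matrix.of g)) = g' r)
    (H : ∀ C', IsSZ C' → (∀ r, g' r ∈ C') → ∃ i, SZEquiv C' (C12 i)) :
    ∃ i, SZEquiv C (C12 i) := by
  refine exists_szEquiv_of_image g' hC α 0 σ τ (fun r => ⟨_, ?_, hM r⟩) H
  rw [Matrix.vecMul_eq_sum]
  exact C.sum_mem fun j _ => C.smul_mem _ (hg j)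

lemma IsSZ.eq_C12 (hC : IsSZ C) {i : Fin 4} (h : ∀ r, (G12 i).row r ∈ C) : C12 i = C := by
  refine Submodule.eq_of_le_of_finrank_eq (Submodule.span_le.2 ?_)
    ((isSZ_C12 i).finrank.trans hC.finrank.symm)
  rintro _ ⟨r, rfl⟩
  exact h r

lemma exists_szEquiv_of_rows {k : ℕ} {g : Fin k → Fin 12 → ZMod 3} (hC : IsSZ C)
    (hg : ∀ j, g j ∈ C) (i : Fin 4) (α : Fin 10 → Fin 2) (σ : Equiv.Perm (Fin 10))
    (τ : Equiv.Perm (Fin 2)) (M : Fin 5 → Fin k → ZMod 3)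
    (hM : ∀ r, szMap α 0 σ τ (Matrix.vecMul (M r) (Matrix.of g)) = (G12 i).row r) :
    ∃ i, SZEquiv C (C12 i) :=
  exists_szEquiv_of_combination (G12 i).row hC hg α σ τ M hM fun _ hC' h =>
    ⟨i, hC'.eq_C12 h ▸ szEquiv_equivalence.refl _⟩

/-- The cyclic permutation of the first three coordinates. -/
def rot₁ : Equiv.Perm (Fin 10) := Equiv.swap 0 1 * Equiv.swap 1 2

/-- The cyclic permutation of the coordinates 4, 5, 6. -/
def rot₂ : Equiv.Perm (Fin 10) := Equiv.swap 3 4 * Equiv.swap 4 5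

/-- The cyclic permutation of the coordinates 7, 8, 9. -/
def rot₃ : Equiv.Perm (Fin 10) := Equiv.swap 6 7 * Equiv.swap 7 8

/-- The word of weight 4 supported on the first block of three coordinates. -/
def block₁ : Fin 12 → ZMod 3 := ![1, 1, 1, 0, 0, 0, 0, 0, 0, 0, 1, 0]

/-- The word of weight 4 supported on the second block of three coordinates. -/
def block₂ : Fin 12 → ZMod 3 := ![0, 0, 0, 1, 1, 1, 0, 0, 0, 0, 1, 0]

/-- The word of weight 4 supported on the third block of three coordinates. -/
def block₃ : Fin 12 → ZMod 3 := ![0, 0, 0, 0, 0, 0, 1, 1, 1, 0, 1, 0]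

/-! #### Three disjoint blocks -/

/-- The word gluing the three blocks. -/
def glue : Fin 12 → ZMod 3 := ![0, 1, 2, 0, 1, 2, 0, 1, 2, 0, 0, 0]

-- Five words determine the code. Each case gives an explicit signed permutation and the
-- combinations that it carries to the rows of the generator matrix.
set_option synthInstance.maxSize 1000 in
set_option maxRecDepth 100000 in
lemma exists_szEquiv_of_glue_last (hC : IsSZ C) {p : ZMod 3} (hp : p = 0 ∨ p = 1)
    (hg : ∀ j, ![block₁, block₂, block₃, glue, ![-1, 0, 0, -1, 0, 0, -1, 0, 0, p, p, 1]] j ∈ C) :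
    ∃ i, SZEquiv C (C12 i) := by
  rcases hp with rfl | rfl
  · exact exists_szEquiv_of_rows hC hg 3 ![1, 1, 1, 1, 0, 0, 1, 1, 1, 1]
      ⟨![6, 5, 2, 7, 8, 9, 1, 4, 0, 3], ![8, 6, 2, 9, 7, 1, 0, 3, 4, 5], by decide, by decide⟩ 1
      ![![0, 0, 0, 0, 1], ![0, 2, 0, 0, 0], ![2, 0, 0, 0, 0], ![1, 1, 1, 1, 1], ![1, 1, 2, 1, 2]]
      (by decide +kernel)
  · exact exists_szEquiv_of_rows hC hg 1 ![0, 0, 0, 0, 0, 1, 0, 0, 0, 0]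
      ⟨![6, 3, 1, 2, 0, 9, 5, 4, 8, 7], ![4, 2, 3, 1, 7, 6, 0, 9, 8, 5], by decide, by decide⟩
      (Equiv.swap 0 1)
      ![![0, 0, 1, 0, 0], ![0, 1, 0, 0, 0], ![2, 2, 2, 2, 2], ![2, 2, 2, 1, 2], ![0, 2, 2, 0, 2]]
      (by decide +kernel)

-- If `y₂ = 0`, the weight of `x` is 0, 1, 4 or 5, which (C1) and (C2) exclude. Rotating the second
-- and third blocks in opposite directions removes `b`: `glue` changes only by a multiple of `block₃
-- - block₂`, whose `y₁` is 0. The tenth sign is free because the earlier words vanish there.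
set_option synthInstance.maxSize 1000 in
set_option maxRecDepth 100000 in
lemma glue_last_normal : ∀ b p y₁ y₂ : ZMod 3,
    Admissible ![-y₂, 0, 0, -y₂ - b, 0, b, -y₂ + b, 0, -b, p, y₁, y₂] →
    (![-y₂, 0, 0, -y₂ - b, 0, b, -y₂ + b, 0, -b, p, y₁, y₂] : Fin 12 → ZMod 3) ≠ 0 →
    ∀ r, szMap (fun i => if i = 9 ∧ y₂ * p = 2 then 1 else 0) 0
      (rot₂ ^ (y₂ * b).val * rot₃ ^ (2 * (y₂ * b).val)) 1 (Matrix.vecMul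
        ((![![1, 0, 0, 0, 0], ![0, 1, 0, 0, 0], ![0, 0, 1, 0, 0], ![0, -(y₂ * b), y₂ * b, 1, 0],
          ![0, y₂ * b * (y₂ * b + 1), y₂ * b * (y₂ * b - 1), 0, y₂]] :
            Matrix (Fin 5) (Fin 5) (ZMod 3)) r)
        (Matrix.of ![block₁, block₂, block₃, glue,
          ![-y₂, 0, 0, -y₂ - b, 0, b, -y₂ + b, 0, -b, p, y₁, y₂]])) =
      ![block₁, block₂, block₃, glue, ![-1, 0, 0, -1, 0, 0, -1, 0, 0, p * p, p * p, 1]] r := by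
  decide +kernel

lemma exists_szEquiv_of_glue (hC : IsSZ C) (hg : ∀ j, ![block₁, block₂, block₃, glue] j ∈ C) :
    ∃ i, SZEquiv C (C12 i) := by
  obtain ⟨v, hv, h0, hk⟩ := hC.exists_vanishing ![1, 2, 4, 7]
  have v1 : v 1 = 0 := hk 0
  have v2 : v 2 = 0 := hk 1
  have v4 : v 4 = 0 := hk 2
  have v7 : v 7 = 0 := hk 3
  have o1 := hC.orth (hg 0) hv
  have o2 := hC.orth (hg 1) hv
  have o3 := hC.orth (hg 2) hv
  have o4 := hC.orth (hg 3) hv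
  simp [block₁, block₂, block₃, glue, v1, v2, v4, v7] at o1 o2 o3 o4
  have h3 : (3 : ZMod 3) = 0 := rfl
  have hvec : v = ![-v 11, 0, 0, -v 11 - v 5, 0, v 5, -v 11 + v 5, 0, -v 5, v 9, v 10, v 11] := by
    conv_lhs => rw [eq_vec v]
    have e0 : v 0 = -v 11 := by linear_combination o1
    have e3 : v 3 = -v 11 - v 5 := by linear_combination o2
    have e8 : v 8 = -v 5 := by linear_combination -o4 + (v 5 + v 8) * h3
    have e6 : v 6 = -v 11 + v 5 := by linear_combination o3 - e8
    rw [e0, e3, e8, e6, v1, v2, v4, v7]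
  generalize v 11 = y₂ at hvec
  generalize v 10 = y₁ at hvec
  generalize v 9 = p at hvec
  generalize v 5 = b at hvec
  subst hvec
  have hsq : ∀ p : ZMod 3, p * p = 0 ∨ p * p = 1 := by decide
  refine exists_szEquiv_of_combination _ hC
    (g := ![block₁, block₂, block₃, glue, _]) (fun j => ?_) _ _ _ _
    (glue_last_normal b p y₁ y₂ (hC.admissible _ hv) h0)
    fun C' hC' hg' => exists_szEquiv_of_glue_last hC' (hsq p) hg'
  fin_cases j
  exacts [hg 0, hg 1, hg 2, hg 3, hv]

-- As `y₂ = 0`, the weight of `x` is 3 or 6. Weight 3 means that `p` and exactly one of `s, t, u`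
-- are non-zero, and `y ≠ 0` by (C3). Subtracting `y` times the corresponding block then gives a
-- word with `wt(x) = 3` and both y-coordinates 0, against (C3).
set_option synthInstance.maxSize 20000 in
set_option maxRecDepth 100000 in
lemma glue_support : ∀ s t u p y : ZMod 3,
    Admissible ![0, s, -s, t, 0, -t, u, 0, -u, p, y, 0] →
    (![0, s, -s, t, 0, -t, u, 0, -u, p, y, 0] : Fin 12 → ZMod 3) ≠ 0 →
    Admissible (![0, s, -s, t, 0, -t, u, 0, -u, p, y, 0] - y • block₁) →
    Admissible (![0, s, -s, t, 0, -t, u, 0, -u, p, y, 0] - y • block₂) →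
    Admissible (![0, s, -s, t, 0, -t, u, 0, -u, p, y, 0] - y • block₃) →
    s ≠ 0 ∧ t ≠ 0 ∧ u ≠ 0 ∧ p = 0 := by
  simp [admissible_iff, block₁, block₂, block₃]
  decide +kernel

-- After scaling by `s`, a swap or a multiple of a block brings the second and third blocks to the
-- form `(0, 1, 2)`. A multiple of `block₁` then cancels `y₁`, and a rotation of the first block
-- undoes its effect on `x`.
set_option synthInstance.maxSize 1000 in
set_option maxRecDepth 100000 in
lemma glue_normal : ∀ s t u y : ZMod 3, s ≠ 0 → t ≠ 0 → u ≠ 0 →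
    ∀ r, szMap 0 0 (rot₁ ^ (s * y + (s * t - 1) + (s * u - 1)).val *
        (if s * t = 1 then Equiv.swap 3 4 else 1) * (if s * u = 1 then Equiv.swap 6 7 else 1)) 1
      (Matrix.vecMul ((![![1, 0, 0, 0], ![0, 1, 0, 0], ![0, 0, 1, 0],
          ![-(s * y + (s * t - 1) + (s * u - 1)), s * t - 1, s * u - 1, s]] :
            Matrix (Fin 4) (Fin 4) (ZMod 3)) r)
        (Matrix.of ![block₁, block₂, block₃, ![0, s, -s, t, 0, -t, u, 0, -u, 0, y, 0]])) =
      ![block₁, block₂, block₃, glue] r := by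
  decide +kernel

lemma exists_szEquiv_of_blocks (hC : IsSZ C) (hg : ∀ j, ![block₁, block₂, block₃] j ∈ C) :
    ∃ i, SZEquiv C (C12 i) := by
  obtain ⟨v, hv, h0, hk⟩ := hC.exists_vanishing ![0, 4, 7, 11]
  have v0 : v 0 = 0 := hk 0
  have v4 : v 4 = 0 := hk 1
  have v7 : v 7 = 0 := hk 2
  have v11 : v 11 = 0 := hk 3
  have o1 := hC.orth (hg 0) hv
  have o2 := hC.orth (hg 1) hv
  have o3 := hC.orth (hg 2) hv
  simp [block₁, block₂, block₃, v0, v4, v7, v11] at o1 o2 o3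
  have hvec : v = ![0, v 1, -v 1, v 3, 0, -v 3, v 6, 0, -v 6, v 9, v 10, 0] := by
    conv_lhs => rw [eq_vec v]
    have e2 : v 2 = -v 1 := by linear_combination o1
    have e5 : v 5 = -v 3 := by linear_combination o2
    have e8 : v 8 = -v 6 := by linear_combination o3
    rw [e2, e5, e8, v0, v4, v7, v11]
  generalize v 1 = s at hvec
  generalize v 3 = t at hvec
  generalize v 6 = u at hvec
  generalize v 9 = p at hvec
  generalize v 10 = y at hvec
  subst hvec
  obtain ⟨hs, ht, hu, rfl⟩ := glue_support s t u p y (hC.admissible _ hv) h0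
    (hC.admissible _ (C.sub_mem hv (C.smul_mem y (hg 0))))
    (hC.admissible _ (C.sub_mem hv (C.smul_mem y (hg 1))))
    (hC.admissible _ (C.sub_mem hv (C.smul_mem y (hg 2))))
  refine exists_szEquiv_of_combination _ hC
    (g := ![block₁, block₂, block₃, _]) (fun j => ?_) _ _ _ _
    (glue_normal s t u y hs ht hu) fun C' hC' hg' => exists_szEquiv_of_glue hC' hg'
  fin_cases j
  exacts [hg 0, hg 1, hg 2, hv]

/-! #### Two disjoint blocks -/

/-- The word of weight 4 on the coordinates 4, 5, 10. -/
def block₂' : Fin 12 → ZMod 3 := ![0, 0, 0, 1, 1, 0, 0, 0, 0, 1, 1, 0]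

/-- The word gluing the second block to the remaining four coordinates. -/
def glue₂ : Fin 12 → ZMod 3 := ![0, 0, 0, 1, 2, 1, 1, 1, 1, 0, 0, 0]

/-- The word gluing the first block to the remaining four coordinates. -/
def glue₁ : Fin 12 → ZMod 3 := ![0, 1, 2, 0, 0, 1, 1, 2, 2, 0, 0, 0]

set_option synthInstance.maxSize 1000 in
set_option maxRecDepth 100000 in
lemma exists_szEquiv_of_glue₁_last (hC : IsSZ C) {a b : ZMod 3}
    (hab : (a, b) = (1, 0) ∨ (a, b) = (0, 1) ∨ (a, b) = (1, 1))
    (hg : ∀ j, ![block₁, block₂', glue₂, glue₁,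
      ![-1, 0, 0, 0, 0, a, -a, b, -b, -1, 2 - a - b, 1]] j ∈ C) :
    ∃ i, SZEquiv C (C12 i) := by
  -- The first two cases lead to the same code.
  rcases hab with h | h | h <;> cases h
  · exact exists_szEquiv_of_rows hC hg 2 ![0, 1, 1, 1, 0, 0, 1, 1, 1, 1]
      ⟨![6, 9, 0, 5, 7, 8, 2, 4, 1, 3], ![2, 8, 6, 9, 7, 3, 0, 4, 5, 1], by decide, by decide⟩ 1
      ![![1, 1, 1, 1, 1], ![0, 2, 0, 0, 0], ![2, 0, 0, 0, 0], ![1, 1, 2, 2, 1], ![0, 0, 2, 1, 0]]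
      (by decide +kernel)
  · exact exists_szEquiv_of_rows hC hg 2 ![0, 1, 1, 1, 0, 0, 1, 1, 1, 1]
      ⟨![8, 9, 0, 7, 5, 6, 1, 4, 2, 3], ![2, 6, 8, 9, 7, 4, 5, 3, 0, 1], by decide, by decide⟩ 1
      ![![1, 1, 1, 2, 1], ![0, 2, 0, 0, 0], ![2, 0, 0, 0, 0], ![1, 1, 2, 1, 1], ![0, 0, 2, 2, 0]]
      (by decide +kernel)
  · exact exists_szEquiv_of_rows hC hg 0 ![0, 0, 1, 0, 1, 1, 0, 0, 0, 0]
      ⟨![3, 1, 8, 7, 5, 6, 2, 0, 9, 4], ![7, 1, 6, 0, 9, 4, 5, 3, 2, 8], by decide, by decide⟩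
      (Equiv.swap 0 1)
      ![![0, 1, 0, 0, 0], ![1, 0, 0, 0, 0], ![0, 2, 1, 0, 2], ![2, 0, 0, 1, 2], ![2, 2, 1, 1, 0]]
      (by decide +kernel)

-- If `y₂ = 0`, the weight of `x` is 0, 2 or 4, which is impossible. So `y₂ ≠ 0`, and `a = b = 0`
-- would give `wt(x) = 2`. The swaps correct the signs of `a` and `b`; they exchange coordinates on
-- which all four earlier words agree.
set_option synthInstance.maxSize 1000 in
set_option maxRecDepth 100000 in
lemma glue₁_last_normal : ∀ a b y₁ y₂ : ZMod 3,
    Admissible ![-y₂, 0, 0, 0, 0, a, -a, b, -b, -y₂, y₁, y₂] →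
    (![-y₂, 0, 0, 0, 0, a, -a, b, -b, -y₂, y₁, y₂] : Fin 12 → ZMod 3) ≠ 0 →
    ((a * a, b * b) = (1, 0) ∨ (a * a, b * b) = (0, 1) ∨ (a * a, b * b) = (1, 1)) ∧
    ∀ r, szMap 0 0 ((if y₂ * a = 2 then Equiv.swap 5 6 else 1) *
        (if y₂ * b = 2 then Equiv.swap 7 8 else 1)) 1 (Matrix.vecMul
        ((![![1, 0, 0, 0, 0], ![0, 1, 0, 0, 0], ![0, 0, 1, 0, 0], ![0, 0, 0, 1, 0],
          ![0, 0, 0, 0, y₂]] : Fin 5 → Fin 5 → ZMod 3) r)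
        (Matrix.of ![block₁, block₂', glue₂, glue₁,
          ![-y₂, 0, 0, 0, 0, a, -a, b, -b, -y₂, y₁, y₂]])) =
      ![block₁, block₂', glue₂, glue₁, ![-1, 0, 0, 0, 0, a * a, -(a * a), b * b, -(b * b), -1,
        2 - a * a - b * b, 1]] r := by
  decide +kernel

lemma exists_szEquiv_of_glue₁ (hC : IsSZ C)
    (hg : ∀ j, ![block₁, block₂', glue₂, glue₁] j ∈ C) : ∃ i, SZEquiv C (C12 i) := by
  obtain ⟨v, hv, h0, hk⟩ := hC.exists_vanishing ![1, 2, 3, 4]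
  have v1 : v 1 = 0 := hk 0
  have v2 : v 2 = 0 := hk 1
  have v3 : v 3 = 0 := hk 2
  have v4 : v 4 = 0 := hk 3
  have o1 := hC.orth (hg 0) hv
  have o2 := hC.orth (hg 1) hv
  have o3 := hC.orth (hg 2) hv
  have o4 := hC.orth (hg 3) hv
  simp [block₁, block₂', glue₂, glue₁, v1, v2, v3, v4] at o1 o2 o3 o4
  have hvec : v = ![-v 11, 0, 0, 0, 0, v 5, -v 5, v 7, -v 7, -v 11, v 10, v 11] := by
    conv_lhs => rw [eq_vec v]
    have e0 : v 0 = -v 11 := by linear_combination o1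
    have e9 : v 9 = -v 11 := by linear_combination o2
    have e6 : v 6 = -v 5 := by linear_combination 2 * o3 - o4
    have e8 : v 8 = -v 7 := by linear_combination o4 - o3
    rw [e0, e9, e6, e8, v1, v2, v3, v4]
  generalize v 11 = y₂ at hvec
  generalize v 10 = y₁ at hvec
  generalize v 5 = a at hvec
  generalize v 7 = b at hvec
  subst hvec
  obtain ⟨hab, hM⟩ := glue₁_last_normal a b y₁ y₂ (hC.admissible _ hv) h0
  refine exists_szEquiv_of_combination _ hC
    (g := ![block₁, block₂', glue₂, glue₁, _]) (fun j => ?_) _ _ _ _ hM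
    fun C' hC' hg' => exists_szEquiv_of_glue₁_last hC' hab hg'
  fin_cases j
  exacts [hg 0, hg 1, hg 2, hg 3, hv]

-- The four entries `p, q, r, -p - q - r` have sum 0, so (C1) leaves two cases: `s` and all four are
-- non-zero, or `s = 0` and three equal entries are non-zero. In the latter case `y ≠ 0`, and one of
-- the words `v - y • block₂' ± glue₂` has `wt(x) = 3` and both y-coordinates 0, against (C3).
set_option synthInstance.maxSize 1000 in
set_option maxRecDepth 100000 in
lemma glue₁_support : ∀ s p q r y : ZMod 3,
    Admissible ![0, s, -s, 0, 0, p, q, r, -p - q - r, 0, y, 0] →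
    (![0, s, -s, 0, 0, p, q, r, -p - q - r, 0, y, 0] : Fin 12 → ZMod 3) ≠ 0 →
    Admissible (![0, s, -s, 0, 0, p, q, r, -p - q - r, 0, y, 0] - y • block₂' + glue₂) →
    Admissible (![0, s, -s, 0, 0, p, q, r, -p - q - r, 0, y, 0] - y • block₂' - glue₂) →
    s ≠ 0 ∧ p ≠ 0 ∧ q ≠ 0 ∧ r ≠ 0 ∧ p + q + r ≠ 0 := by
  simp [admissible_iff, block₂', glue₂]
  decide +kernel

-- Four non-zero entries with sum 0 are two 1s and two 2s, so a swap arranges them as in `glue₁`.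
-- The first block is treated by a swap and a rotation compensating a multiple of `block₁`.
set_option synthInstance.maxSize 1000 in
set_option maxRecDepth 100000 in
lemma glue₁_normal : ∀ s p q r y : ZMod 3, s ≠ 0 → p ≠ 0 → q ≠ 0 → r ≠ 0 → p + q + r ≠ 0 →
    ∀ i, szMap 0 0 ((if p * s = 2 then Equiv.swap 1 2 else 1) * rot₁ ^ (p * y).val *
        (if p * q = 1 then 1 else if p * r = 1 then Equiv.swap 6 7 else Equiv.swap 6 8)) 1
      (Matrix.vecMul ((![![1, 0, 0, 0], ![0, 1, 0, 0], ![0, 0, 1, 0], ![-(p * y), 0, 0, p]] :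
            Fin 4 → Fin 4 → ZMod 3) i)
        (Matrix.of ![block₁, block₂', glue₂, ![0, s, -s, 0, 0, p, q, r, -p - q - r, 0, y, 0]])) =
      ![block₁, block₂', glue₂, glue₁] i := by
  decide +kernel

lemma exists_szEquiv_of_glue₂ (hC : IsSZ C) (hg : ∀ j, ![block₁, block₂', glue₂] j ∈ C) :
    ∃ i, SZEquiv C (C12 i) := by
  obtain ⟨v, hv, h0, hk⟩ := hC.exists_vanishing ![0, 3, 4, 11]
  have v0 : v 0 = 0 := hk 0
  have v3 : v 3 = 0 := hk 1
  have v4 : v 4 = 0 := hk 2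
  have v11 : v 11 = 0 := hk 3
  have o1 := hC.orth (hg 0) hv
  have o2 := hC.orth (hg 1) hv
  have o3 := hC.orth (hg 2) hv
  simp [block₁, block₂', glue₂, v0, v3, v4, v11] at o1 o2 o3
  have hvec : v = ![0, v 1, -v 1, 0, 0, v 5, v 6, v 7, -v 5 - v 6 - v 7, 0, v 10, 0] := by
    conv_lhs => rw [eq_vec v]
    have e2 : v 2 = -v 1 := by linear_combination o1
    have e8 : v 8 = -v 5 - v 6 - v 7 := by linear_combination o3
    rw [e2, o2, e8, v0, v3, v4, v11]
  generalize v 1 = s at hvec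
  generalize v 5 = p at hvec
  generalize v 6 = q at hvec
  generalize v 7 = r at hvec
  generalize v 10 = y at hvec
  subst hvec
  have hm := C.sub_mem hv (C.smul_mem y (hg 1))
  obtain ⟨hs, hp, hq, hr, hpqr⟩ := glue₁_support s p q r y (hC.admissible _ hv) h0
    (hC.admissible _ (C.add_mem hm (hg 2))) (hC.admissible _ (C.sub_mem hm (hg 2)))
  refine exists_szEquiv_of_combination _ hC
    (g := ![block₁, block₂', glue₂, _]) (fun j => ?_) _ _ _ _
    (glue₁_normal s p q r y hs hp hq hr hpqr) fun C' hC' hg' => exists_szEquiv_of_glue₁ hC' hg'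
  fin_cases j
  exacts [hg 0, hg 1, hg 2, hv]

/-! #### The first block and a second word of weight 4 -/

set_option synthInstance.maxSize 1000 in
set_option maxRecDepth 100000 in
lemma glue_blocks_normal : ∀ a d e f : ZMod 3, a ≠ 0 → d ≠ 0 → e ≠ 0 → f ≠ 0 →
    ∀ i, szMap (fun i => if i = 6 ∧ a * d = 1 ∨ i = 7 ∧ a * e = 1 ∨ i = 8 ∧ a * f = 1 then 1
        else 0) 0 1 1
      (Matrix.vecMul ((![![1, 0, 0], ![0, 1, 0], ![0, 1, -a]] : Fin 3 → Fin 3 → ZMod 3) i)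
        (Matrix.of ![block₁, block₂, ![0, 0, 0, a, a, a, d, e, f, 0, 0, 0]])) =
      ![block₁, block₂, block₃] i := by
  decide +kernel

set_option synthInstance.maxSize 1000 in
set_option maxRecDepth 100000 in
lemma glue₂_normal : ∀ a c d e f : ZMod 3, a ≠ 0 → c ≠ 0 → d ≠ 0 → e ≠ 0 → f ≠ 0 →
    ∀ i, szMap (fun i => if i = 5 ∧ a * c = 2 ∨ i = 6 ∧ a * d = 2 ∨ i = 7 ∧ a * e = 2 ∨
        i = 8 ∧ a * f = 2 then 1 else 0) 0 1 1
      (Matrix.vecMul ((![![1, 0, 0], ![0, 1, 0], ![0, 0, a]] : Fin 3 → Fin 3 → ZMod 3) i)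
        (Matrix.of ![block₁, block₂', ![0, 0, 0, a, -a, c, d, e, f, 0, 0, 0]])) =
      ![block₁, block₂', glue₂] i := by
  decide +kernel

/-- Orthogonality to `block₂` makes `t` constant, say `a`, on the second block, so `block₂ - a • t`
is a third block up to signs. Orthogonality to `block₂'` gives `t 4 = -t 3`, so `t` becomes `glue₂`
after scaling and sign changes. Only the support of `t` is prescribed, since normalizing the second
word may alter its signs. -/
lemma exists_szEquiv_of_block₂_or_block₂' (hC : IsSZ C) (h1 : block₁ ∈ C)
    (h2 : block₂ ∈ C ∨ block₂' ∈ C) {t : Fin 12 → ZMod 3} (ht : t ∈ C)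
    (h0 : ∀ i : Fin 12, t i = 0 ↔ (i : ℕ) < 3 ∨ 9 ≤ (i : ℕ)) : ∃ i, SZEquiv C (C12 i) := by
  have t0 : t 0 = 0 := (h0 0).2 (by decide)
  have t1 : t 1 = 0 := (h0 1).2 (by decide)
  have t2 : t 2 = 0 := (h0 2).2 (by decide)
  have t9 : t 9 = 0 := (h0 9).2 (by decide)
  have t10 : t 10 = 0 := (h0 10).2 (by decide)
  have t11 : t 11 = 0 := (h0 11).2 (by decide)
  have t3 : t 3 ≠ 0 := fun h => absurd ((h0 3).1 h) (by decide)
  have t4 : t 4 ≠ 0 := fun h => absurd ((h0 4).1 h) (by decide)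
  have t5 : t 5 ≠ 0 := fun h => absurd ((h0 5).1 h) (by decide)
  have t6 : t 6 ≠ 0 := fun h => absurd ((h0 6).1 h) (by decide)
  have t7 : t 7 ≠ 0 := fun h => absurd ((h0 7).1 h) (by decide)
  have t8 : t 8 ≠ 0 := fun h => absurd ((h0 8).1 h) (by decide)
  rcases h2 with h2 | h2
  · have o := hC.orth h2 ht
    simp [block₂, t11] at o
    have hs : ∀ a b c : ZMod 3, a ≠ 0 → b ≠ 0 → c ≠ 0 → a + b + c = 0 → b = a ∧ c = a := by
      decide
    obtain ⟨e4, e5⟩ := hs _ _ _ t3 t4 t5 o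
    refine exists_szEquiv_of_combination _ hC
      (g := ![block₁, block₂, ![0, 0, 0, t 3, t 3, t 3, t 6, t 7, t 8, 0, 0, 0]]) (fun j => ?_)
      _ _ _ _ (glue_blocks_normal (t 3) (t 6) (t 7) (t 8) t3 t6 t7 t8)
      fun C' hC' hg' => exists_szEquiv_of_blocks hC' hg'
    rw [eq_vec t, t0, t1, t2, e4, e5, t9, t10, t11] at ht
    fin_cases j
    exacts [h1, h2, ht]
  · have o := hC.orth h2 ht
    simp [block₂', t9, t11] at o
    have e4 : t 4 = -t 3 := by linear_combination o
    refine exists_szEquiv_of_combination _ hC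
      (g := ![block₁, block₂', ![0, 0, 0, t 3, -t 3, t 5, t 6, t 7, t 8, 0, 0, 0]]) (fun j => ?_)
      _ _ _ _ (glue₂_normal (t 3) (t 5) (t 6) (t 7) (t 8) t3 t5 t6 t7 t8)
      fun C' hC' hg' => exists_szEquiv_of_glue₂ hC' hg'
    rw [eq_vec t, t0, t1, t2, e4, t9, t10, t11] at ht
    fin_cases j
    exacts [h1, h2, ht]

lemma forall_fin_ten_add_two {p : Fin 12 → Prop} (hx : ∀ i : Fin 10, p (Fin.castAdd 2 i))
    (hy : ∀ j : Fin 2, p (Fin.natAdd 10 j)) (i : Fin 12) : p i :=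
  Fin.addCases (m := 10) (n := 2) hx hy i

/-- The embedding of an initial segment into the coordinates from the fourth on. -/
def shiftThree (m : ℕ) (h : m ≤ 7) : Fin m ↪ Fin 10 where
  toFun j := ⟨j + 3, by omega⟩
  inj' i j h := by simpa [Fin.ext_iff] using h

lemma val_shiftThree {m : ℕ} (h : m ≤ 7) (j : Fin m) : (shiftThree m h j : ℕ) = j + 3 := rfl

lemma mem_range_shiftThree {m : ℕ} {h : m ≤ 7} {i : Fin 10} :
    i ∈ Set.range (shiftThree m h) ↔ 3 ≤ (i : ℕ) ∧ (i : ℕ) < m + 3 := by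
  constructor
  · rintro ⟨j, rfl⟩
    rw [val_shiftThree]
    omega
  · rintro ⟨h1, h2⟩
    exact ⟨⟨i - 3, by omega⟩, Fin.ext (by rw [val_shiftThree]; exact Nat.sub_add_cancel h1)⟩

lemma szMap_block₁ {m : ℕ} (h : m ≤ 7) {x : Fin 10 → ZMod 3}
    (hx : ∀ i : Fin 10, (i : ℕ) < 3 → x i = 0)
    {α : Fin 10 → Fin 2} {σ : Equiv.Perm (Fin 10)}
    (hd : ∀ d : Fin 10 → ZMod 3, (∀ j, d (shiftThree m h j) = 0) →
      (∀ i ∉ Set.range (shiftThree m h), x i = 0 ∨ d i = 0) → signedPerm α σ d = d) :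
    szMap α 0 σ 1 block₁ = block₁ := by
  have hb : ∀ i : Fin 10, 3 ≤ (i : ℕ) → xPart block₁ i = 0 := by decide
  have := hd (xPart block₁) (fun j => hb _ (by rw [val_shiftThree]; omega)) fun i _ =>
    (lt_or_ge (i : ℕ) 3).imp (hx i) (hb i)
  refine funext (forall_fin_ten_add_two (fun i => ?_) fun j => ?_)
  · exact congrFun ((xPart_szMap _ _ _ _ _).trans this) i
  · rw [szMap_natAdd]
    exact one_mul _

lemma hammingNorm_eq_sum {n : ℕ} (x : Fin n → ZMod 3) :
    hammingNorm x = ∑ i, if x i = 0 then 0 else 1 := by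
  simp [hammingNorm, Finset.card_filter]

lemma hammingNorm_shiftThree (x : Fin 10 → ZMod 3) (h0 : x 0 = 0) (h1 : x 1 = 0) (h2 : x 2 = 0) :
    hammingNorm x = hammingNorm (x ∘ shiftThree 6 (by decide)) + if x 9 = 0 then 0 else 1 := by
  have hs : x ∘ shiftThree 6 (by decide) = ![x 3, x 4, x 5, x 6, x 7, x 8] := by
    ext j; fin_cases j <;> rfl
  rw [hs, hammingNorm_eq_sum, hammingNorm_eq_sum]
  simp only [Fin.sum_univ_succ, Fin.sum_univ_zero]
  simp [h0, h1, h2, add_assoc]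
  rfl

lemma exists_szEquiv_of_second_word (hC : IsSZ C) (h1 : block₁ ∈ C) {t u : Fin 12 → ZMod 3}
    (ht : t ∈ C) (h0 : ∀ i : Fin 12, t i = 0 ↔ (i : ℕ) < 3 ∨ 9 ≤ (i : ℕ)) (hu : u ∈ C)
    (u0 : u 0 = 0) (u1 : u 1 = 0) (u2 : u 2 = 0) (u10 : u 10 = 1) (u11 : u 11 = 0)
    (hw : hammingNorm (xPart u) = 3) : ∃ i, SZEquiv C (C12 i) := by
  have hx : ∀ i : Fin 10, (i : ℕ) < 3 → xPart u i = 0 := by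
    intro i hi
    obtain rfl | rfl | rfl : i = 0 ∨ i = 1 ∨ i = 2 := by omega
    exacts [u0, u1, u2]
  obtain ⟨α, σ, hσ, hσ', hα, hk, hd⟩ := exists_perm_support (shiftThree 6 (by decide)) (xPart u)
  have hn := hammingNorm_shiftThree (xPart u) u0 u1 u2
  have hσ3 : ∀ i : Fin 10, (i : ℕ) < 3 → σ i = i := fun i hi =>
    hσ i fun h => absurd (mem_range_shiftThree.1 h).1 (by omega)
  have hσ9 : σ 9 = 9 := hσ 9 fun h => absurd (mem_range_shiftThree.1 h).2 (by decide)
  have hu' : ∀ k : ℕ, hammingNorm (xPart u ∘ shiftThree 6 (by decide)) = k →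
      (∀ i : Fin 10, szMap α 0 σ 1 u (Fin.castAdd 2 i) = if (3 ≤ (i : ℕ) ∧ (i : ℕ) < k + 3 ∧
        (i : ℕ) < 9) ∨ ((i : ℕ) = 9 ∧ xPart u 9 ≠ 0) then 1 else 0) := by
    rintro k rfl i
    refine (congrFun (xPart_szMap α 0 σ 1 u) i).trans ((hα i).trans ?_)
    obtain hi | hi | rfl : (i : ℕ) < 3 ∨ i ∈ Set.range (shiftThree 6 (by decide)) ∨ i = 9 := by
      rw [mem_range_shiftThree]; omega
    · rw [hσ3 i hi, hx i hi]
      rw [if_pos rfl, if_neg (by omega)]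
    · have hi' := mem_range_shiftThree.1 hi
      obtain ⟨j, rfl⟩ := hi
      have hj : ((shiftThree 6 (by decide) j : Fin 10) : ℕ) = j + 3 := rfl
      rw [hj] at hi' ⊢
      by_cases hjk : hammingNorm (xPart u ∘ shiftThree 6 (by decide)) ≤ j
      · rw [if_pos ((hk j).2 hjk), if_neg (by omega)]
      · rw [if_neg (fun h => hjk ((hk j).1 h)), if_pos (by omega)]
    · rw [hσ9]
      by_cases h9 : xPart u 9 = 0
      · rw [if_pos h9, if_neg (by simp [h9])]
      · rw [if_neg h9, if_pos (by simp [h9])]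
  have huy : ∀ j : Fin 2, szMap α 0 σ 1 u (Fin.natAdd 10 j) = if j = 0 then 1 else 0 := by
    intro j
    rw [szMap_natAdd]
    fin_cases j
    · exact (one_mul _).trans u10
    · exact (one_mul _).trans u11
  refine exists_szEquiv_of_image ![block₁, szMap α 0 σ 1 u, szMap α 0 σ 1 t] hC α 0 σ 1
    (fun r => ?_) fun C' hC' hg => exists_szEquiv_of_block₂_or_block₂' hC' (hg 0) ?_ (hg 2) ?_
  · fin_cases r
    exacts [⟨_, h1, szMap_block₁ _ hx hd⟩, ⟨_, hu, rfl⟩, ⟨_, ht, rfl⟩]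
  -- The tenth coordinate lies outside the support of `t` and is not moved: if `u` vanishes there,
  -- all three non-zero entries move to the front of the six, otherwise only two do.
  · by_cases h9 : xPart u 9 = 0
    · left
      convert hg 1
      rw [hw, if_pos h9] at hn
      refine (funext (forall_fin_ten_add_two (fun i => ?_) fun j => ?_)).symm
      · refine (hu' 3 hn.symm i).trans ?_
        simp only [h9, ne_eq, not_true, and_false, or_false]
        revert i
        decide
      · refine (huy j).trans ?_
        revert j
        decide
    · right
      convert hg 1
      rw [hw, if_neg h9] at hn
      refine (funext (forall_fin_ten_add_two (fun i => ?_) fun j => ?_)).symm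
      · refine (hu' 2 (by omega) i).trans ?_
        simp only [h9, ne_eq, not_false_eq_true, and_true]
        revert i
        decide
      · refine (huy j).trans ?_
        revert j
        decide
  · refine forall_fin_ten_add_two (fun i => ?_) fun j => ?_
    · change szMap α 0 σ 1 t _ = 0 ↔ _
      rw [szMap_castAdd, neg_one_pow_mul_eq_zero, h0, Fin.val_castAdd, Fin.val_castAdd]
      obtain hi | hi | rfl : (i : ℕ) < 3 ∨ i ∈ Set.range (shiftThree 6 (by decide)) ∨ i = 9 := by
        rw [mem_range_shiftThree]; omega
      · rw [hσ3 i hi]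
      · have hi1 := mem_range_shiftThree.1 hi
        obtain ⟨j, rfl⟩ := hi
        have hi2 := mem_range_shiftThree.1 (hσ' j)
        omega
      · rw [hσ9]
    · change szMap α 0 σ 1 t _ = 0 ↔ _
      rw [szMap_natAdd, neg_one_pow_mul_eq_zero, h0]
      exact iff_of_true (Or.inr (by simp; omega)) (Or.inr (by simp; omega))

/-! #### The first block -/

/-- The word of weight 6 supported on the coordinates 4, …, 9. -/
def sixOnes : Fin 12 → ZMod 3 := ![0, 0, 0, 1, 1, 1, 1, 1, 1, 0, 0, 0]

-- Let `n₀, n₁, n₂` count the values among the six entries. Their sum is 0, so `n₀ ≡ n₁ ≡ n₂` mod 3,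
-- and (C1) makes all three congruent to 0 if `p = 0` and to 1 otherwise. As one entry is 0 and the
-- word is non-zero, some value occurs three times if `p = 0` and four times otherwise; shifting it
-- to 0 leaves `wt(x) = 3`. Then `y ≠ 0` by (C3).
set_option synthInstance.maxSize 1000 in
set_option maxRecDepth 100000 in
lemma exists_weight_three_combination : ∀ a b c d p y : ZMod 3,
    Admissible ![0, 0, 0, 0, a, b, c, d, -a - b - c - d, p, y, 0] →
    (![0, 0, 0, 0, a, b, c, d, -a - b - c - d, p, y, 0] : Fin 12 → ZMod 3) ≠ 0 →
    Admissible (![0, 0, 0, 0, a, b, c, d, -a - b - c - d, p, y, 0] + sixOnes) →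
    Admissible (![0, 0, 0, 0, a, b, c, d, -a - b - c - d, p, y, 0] - sixOnes) →
    y ≠ 0 ∧ ∃ k : ZMod 3, hammingNorm (xPart
      (y • (![0, 0, 0, 0, a, b, c, d, -a - b - c - d, p, y, 0] + k • sixOnes))) = 3 := by
  simp [admissible_iff, sixOnes, hammingNorm_xPart]
  decide +kernel

lemma exists_szEquiv_of_sixOnes (hC : IsSZ C) (h1 : block₁ ∈ C) (h2 : sixOnes ∈ C) :
    ∃ i, SZEquiv C (C12 i) := by
  obtain ⟨v, hv, h0, hk⟩ := hC.exists_vanishing ![0, 1, 2, 3]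
  have v0 : v 0 = 0 := hk 0
  have v1 : v 1 = 0 := hk 1
  have v2 : v 2 = 0 := hk 2
  have v3 : v 3 = 0 := hk 3
  have o1 := hC.orth h1 hv
  have o2 := hC.orth h2 hv
  simp [block₁, sixOnes, v0, v1, v2, v3] at o1 o2
  have hvec : v = ![0, 0, 0, 0, v 4, v 5, v 6, v 7, -v 4 - v 5 - v 6 - v 7, v 9, v 10, 0] := by
    conv_lhs => rw [eq_vec v]
    have e8 : v 8 = -v 4 - v 5 - v 6 - v 7 := by linear_combination o2
    rw [o1, e8, v0, v1, v2, v3]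
  generalize v 4 = a at hvec
  generalize v 5 = b at hvec
  generalize v 6 = c at hvec
  generalize v 7 = d at hvec
  generalize v 9 = p at hvec
  generalize v 10 = y at hvec
  subst hvec
  obtain ⟨hy, k, hw⟩ := exists_weight_three_combination a b c d p y (hC.admissible _ hv) h0
    (hC.admissible _ (C.add_mem hv h2)) (hC.admissible _ (C.sub_mem hv h2))
  -- The factor `y` is its own inverse and makes the first y-coordinate 1.
  have hyy : ∀ y : ZMod 3, y ≠ 0 → y * y = 1 := by decide
  exact exists_szEquiv_of_second_word hC h1 h2 (by decide)
    (C.smul_mem y (C.add_mem hv (C.smul_mem k h2))) (by simp [sixOnes]) (by simp [sixOnes])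
    (by simp [sixOnes]) (by simpa [sixOnes] using hyy y hy) (by simp [sixOnes]) hw

lemma exists_szEquiv_of_block₁ (hC : IsSZ C) (h1 : block₁ ∈ C) : ∃ i, SZEquiv C (C12 i) := by
  obtain ⟨t, ht, h0, hk⟩ := hC.exists_vanishing ![0, 1, 2, 10]
  have t0 : t 0 = 0 := hk 0
  have t1 : t 1 = 0 := hk 1
  have t2 : t 2 = 0 := hk 2
  have t10 : t 10 = 0 := hk 3
  have t11 := hC.orth h1 ht
  simp [block₁, t0, t1, t2] at t11
  have hx : ∀ i : Fin 10, (i : ℕ) < 3 → xPart t i = 0 := by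
    intro i hi
    obtain rfl | rfl | rfl : i = 0 ∨ i = 1 ∨ i = 2 := by omega
    exacts [t0, t1, t2]
  obtain ⟨α, σ, hσ, -, hα, hk, hd⟩ := exists_perm_support (shiftThree 7 (by decide)) (xPart t)
  -- Both y-coordinates of `t` vanish, so `wt(x)` is a multiple of 3 other than 0 and 3, and only
  -- seven coordinates are left.
  have hw : hammingNorm (xPart t ∘ shiftThree 7 (by decide)) = 6 := by
    have hn : hammingNorm (xPart t ∘ shiftThree 7 (by decide)) = hammingNorm (xPart t) :=
      hammingNorm_comp_embedding _ _ fun i hi => hx i <| by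
        rw [mem_range_shiftThree] at hi; omega
    have h7 := hammingNorm_le_card_fintype (x := xPart t ∘ shiftThree 7 (by decide))
    rw [hn, Fintype.card_fin] at h7
    obtain ⟨ha1, ha2, ha3⟩ := hC.admissible t ht
    have hy0 : yPart t 0 = 0 := t10
    have hy1 : yPart t 1 = 0 := t11
    rw [hy0, zero_mul] at ha1
    have hdvd := (ZMod.natCast_eq_zero_iff _ _).1 ha1
    have h3 := ha2 h0
    have h3' : hammingNorm (xPart t) ≠ 3 := fun h => ha3 h (by rw [hy0, hy1])
    rw [hn]
    omega
  refine exists_szEquiv_of_image ![block₁, sixOnes] hC α 0 σ 1 (fun r => ?_)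
    fun C' hC' hg => exists_szEquiv_of_sixOnes hC' (hg 0) (hg 1)
  fin_cases r
  · exact ⟨_, h1, szMap_block₁ _ hx hd⟩
  refine ⟨_, ht, funext (forall_fin_ten_add_two (fun i => ?_) fun j => ?_)⟩
  · refine (congrFun (xPart_szMap α 0 σ 1 t) i).trans ((hα i).trans ?_)
    have hval : ∀ i : Fin 10, sixOnes (Fin.castAdd 2 i) =
        if 3 ≤ (i : ℕ) ∧ (i : ℕ) < 9 then 1 else 0 := by decide
    refine Eq.trans ?_ (hval i).symm
    obtain hi | hi : (i : ℕ) < 3 ∨ i ∈ Set.range (shiftThree 7 (by decide)) := by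
      rw [mem_range_shiftThree]; omega
    · rw [hσ i fun h => absurd (mem_range_shiftThree.1 h).1 (by omega), hx i hi, if_pos rfl,
        if_neg (by omega)]
    · obtain ⟨j, rfl⟩ := hi
      rw [val_shiftThree]
      by_cases hj : 6 ≤ (j : ℕ)
      · rw [if_pos ((hk j).2 (hw.trans_le hj)), if_neg (by omega)]
      · rw [if_neg fun h => hj (hw.symm.trans_le ((hk j).1 h)), if_pos (by omega)]
  · rw [szMap_natAdd]
    fin_cases j
    · exact (one_mul _).trans t10
    · exact (one_mul _).trans t11

theorem IsSZ.exists_szEquiv (hC : IsSZ C) (h : ∃ c ∈ C, hammingNorm (xPart c) = 3) :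
    ∃ i, SZEquiv C (C12 i) := by
  obtain ⟨c, hc, hw⟩ := h
  obtain ⟨α, σ, -, -, hα, hk, -⟩ := exists_perm_support (Embedding.refl (Fin 10)) (xPart c)
  obtain ⟨β, τ, hy⟩ : ∃ (β : Fin 2) (τ : Equiv.Perm (Fin 2)), ∀ j : Fin 2,
      (-1) ^ (β : ℕ) * yPart c (τ j) = if j = 0 then 1 else 0 := by
    -- Exactly one y-coordinate is non-zero: `τ` moves it to the front and `β` makes it 1. Later
    -- reductions need only `β = 0`, since words can be rescaled.
    have key : ∀ y : Fin 2 → ZMod 3, y 0 * y 1 = 0 → (y 0, y 1) ≠ (0, 0) →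
        ∃ (β : Fin 2) (τ : Equiv.Perm (Fin 2)), ∀ j : Fin 2,
          (-1) ^ (β : ℕ) * y (τ j) = if j = 0 then 1 else 0 := by
      decide +kernel
    obtain ⟨ha1, -, ha3⟩ := hC.admissible c hc
    rw [hw] at ha1
    exact key _ ha1.symm (ha3 hw)
  refine exists_szEquiv_of_image ![block₁] hC α β σ τ (fun r => ⟨c, hc, ?_⟩)
    fun C' hC' hg => exists_szEquiv_of_block₁ hC' (hg 0)
  rw [Subsingleton.elim r 0]
  refine funext (forall_fin_ten_add_two (fun i => ?_) fun j => ?_)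
  · refine (congrFun (xPart_szMap α β σ τ c) i).trans ((hα i).trans ?_)
    have hval : ∀ i : Fin 10, block₁ (Fin.castAdd 2 i) = if 3 ≤ (i : ℕ) then 0 else 1 := by decide
    refine Eq.trans (if_congr ?_ rfl rfl) (hval i).symm
    have hw' : hammingNorm (xPart c ∘ Embedding.refl (Fin 10)) = 3 := hw
    have := hk i
    rwa [hw'] at this
  · refine (szMap_natAdd α β σ τ c j).trans ((hy j).trans ?_)
    revert j
    decide

/-! ### The classification theorem -/

theorem mainTheorem4 :
    -- up to SZ-equivalence there are exactly four ternary [12,5,4] codes with the conditions,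
    Nat.card (Quotient szSetoid) = 4 ∧
    -- and the four codes `C12 i` form a complete set of representatives
    (∀ i : Fin 4, IsTernaryCode (C12 i) 5 4 ∧ SZConditions (C12 i)) ∧
    (∀ C : Submodule (ZMod 3) (Fin 12 → ZMod 3), IsTernaryCode C 5 4 → SZConditions C →
      ∃! i : Fin 4, SZEquiv C (C12 i)) ∧
    -- their punctured codes are the pairwise inequivalent [10,5,3] codes `C10 i`
    (∀ i : Fin 4, Pun (C12 i) = C10 i ∧ IsTernaryCode (C10 i) 5 3) ∧
    (∀ i j : Fin 4, CodeEquiv (C10 i) (C10 j) → i = j) ∧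
    (∀ C : Submodule (ZMod 3) (Fin 12 → ZMod 3), IsTernaryCode C 5 4 → SZConditions C →
      IsTernaryCode (Pun C) 5 3 ∧ ∃! i : Fin 4, CodeEquiv (Pun C) (C10 i)) := by
  have hrep : ∀ i : Fin 4, IsTernaryCode (C12 i) 5 4 ∧ SZConditions (C12 i) := fun i =>
    ⟨(isSZ_C12 i).isTernaryCode (exists_weight_three_C12 i),
      szConditions_iff.2 (isSZ_C12 i).admissible⟩
  have hpun : ∀ {C : Submodule (ZMod 3) (Fin 12 → ZMod 3)} {i : Fin 4}, SZEquiv C (C12 i) →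
      CodeEquiv (Pun C) (C10 i) := fun {C i} h => pun_C12 i ▸ CodeEquiv.of_szEquiv h
  have hsz : ∀ {C : Submodule (ZMod 3) (Fin 12 → ZMod 3)}, IsTernaryCode C 5 4 →
      SZConditions C → IsSZ C := fun h1 h2 => ⟨h1.1, szConditions_iff.1 h2⟩
  have hex : ∀ C : Submodule (ZMod 3) (Fin 12 → ZMod 3), IsTernaryCode C 5 4 →
      SZConditions C → ∃! i : Fin 4, SZEquiv C (C12 i) := fun C h1 h2 => by
    obtain ⟨i, hi⟩ := (hsz h1 h2).exists_szEquiv ((hsz h1 h2).exists_weight_three h1)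
    exact ⟨i, hi, fun j hj => C10_injective_of_codeEquiv (hpun hj) (hpun hi)⟩
  refine ⟨?_, hrep, hex, fun i => ⟨pun_C12 i, ?_⟩, fun i j hij =>
    C10_injective_of_codeEquiv (codeEquiv_refl _) hij, fun C h1 h2 => ⟨?_, ?_⟩⟩
  · let f : Fin 4 → Quotient szSetoid := fun i => Quotient.mk szSetoid ⟨C12 i, hrep i⟩
    have hf : Bijective f := by
      refine ⟨fun i j hij => ?_, fun q => ?_⟩
      · have h : SZEquiv (C12 i) (C12 j) := Quotient.exact hij
        exact C10_injective_of_codeEquiv (hpun (szEquiv_equivalence.refl _)) (hpun h)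
      · induction q using Quotient.inductionOn with
        | h C =>
          obtain ⟨i, hi, -⟩ := hex C.1 C.2.1 C.2.2
          exact ⟨i, Quotient.sound (szEquiv_equivalence.symm hi)⟩
    rw [← Nat.card_eq_of_bijective f hf, Nat.card_fin]
  · rw [← pun_C12]
    exact (isSZ_C12 i).isTernaryCode_pun (exists_weight_three_C12 i)
  · exact (hsz h1 h2).isTernaryCode_pun ((hsz h1 h2).exists_weight_three h1)
  · obtain ⟨i, hi, -⟩ := hex C h1 h2
    exact ⟨i, hpun hi, fun j hj => C10_injective_of_codeEquiv hj (hpun hi)⟩
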